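/- Let $\mathbb{T}^1=\mathbb{R}/\mathbb{Z}$, let $\Theta$ be a compact metric space and let $r:\Theta\to\Theta$ be a continuous map with exactly one $r$-invariant Borel probability measure. Let $f:\Theta\times\mathbb{T}^1\to\Theta\times\mathbb{T}^1$ be a continuous map of the form $f(\theta,\varphi)=(r(\theta),f_\theta(\varphi))$ that is homotopic to $(\theta,\varphi)\mapsto(r(\theta),\varphi)$. Let $\pi:\Theta\times\mathbb{R}\to\Theta\times\mathbb{T}^1$ be the natural projection and let $F:\Theta\times\mathbb{R}\to\Theta\times\mathbb{R}$, $F(\theta,x)=(r(\theta),F_\theta(x))$, be a continuous lift of $f$, that is, $\pi\circ F=f\circ\pi$. Write $F^n_\theta=F_{r^{n-1}(\theta)}\circ\dots\circ F_\theta$ and $$\rho_{\mathrm{fib}}(F)=\Big\{\limsup_{n\to\infty}\tfrac1n\big(F^n_\theta(x)-x\big)\ :\ (\theta,x)\in\Theta\times\mathbb{R}\Big\}.$$ Then $\rho_{\mathrm{fib}}(F)$ is a nonempty compact interval $[a,b]$, $a\le b$ (possibly a single point). Moreover, for every $\rho\in\rho_{\mathrm{fib}}(F)$ there is a minimal set $M_\rho\subseteq\Theta\times\mathbb{T}^1$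 of $f$ (a nonempty closed set with $f(M_\rho)\subseteq M_\rho$ that has no proper nonempty closed subset $N$ with $f(N)\subseteq N$) such that (i) $\frac1n(F^n_\theta(x)-x)$ converges to $\rho$ as $n\to\infty$, uniformly in $(\theta,x)\in\pi^{-1}(M_\rho)$; (ii) if $h_{\mathrm{top}}(r)=0$ (as is the case, for instance, for an irrational rotation $r$ of $\Theta=\mathbb{T}^1$), then $h_{\mathrm{top}}(f|_{M_\rho})=0$, where $h_{\mathrm{top}}$ denotes topological entropy. -/

import Mathlib

open Filter Topology MeasureTheory

noncomputable section

/-- `r` has exactly one invariant Borel probability measure. -/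
def IsUniquelyErgodic {Θ : Type*} [MeasurableSpace Θ] (r : Θ → Θ) : Prop :=
  ∃! μ : Measure Θ, IsProbabilityMeasure μ ∧ MeasurePreserving r μ μ

/-- The natural projection `Θ × ℝ → Θ × ℝ/ℤ`. -/
def circleProj (Θ : Type*) (p : Θ × ℝ) : Θ × UnitAddCircle :=
  (p.1, (p.2 : UnitAddCircle))

/-- `f (θ, φ) = (r θ, f_θ φ)`: `f` is a skew product over `r`. -/
def IsSkewProductOver {Θ : Type*} (r : Θ → Θ) (f : Θ × UnitAddCircle → Θ × UnitAddCircle) : Prop :=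
  ∀ p, (f p).1 = r p.1

/-- A skew product `f` over `r` is called homotopic to the identity if it is homotopic to
`(θ, φ) ↦ (r θ, φ)`. -/
def IsHomotopicToId {Θ : Type*} [TopologicalSpace Θ] (r : C(Θ, Θ))
    (f : C(Θ × UnitAddCircle, Θ × UnitAddCircle)) : Prop :=
  ContinuousMap.Homotopic f (r.prodMap (ContinuousMap.id UnitAddCircle))

/-- `F` is a (continuous) lift of `f` to `Θ × ℝ`. -/
def IsLift {Θ : Type*} [TopologicalSpace Θ] (F : C(Θ × ℝ, Θ × ℝ))
    (f : C(Θ × UnitAddCircle, Θ × UnitAddCircle)) : Prop :=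
  ∀ p, circleProj Θ (F p) = f (circleProj Θ p)

/-- The quotient `(F^n_θ(x) - x) / n` at `p = (θ, x)`. For `F (θ, x) = (r θ, F_θ x)`, the second
coordinate of the `n`-th iterate of `F` at `(θ, x)` is
`F^n_θ(x) = (F_{r^{n-1} θ} ∘ ⋯ ∘ F_θ) (x)`. -/
def rotationQuotient {Θ : Type*} (F : Θ × ℝ → Θ × ℝ) (n : ℕ) (p : Θ × ℝ) : ℝ :=
  ((F^[n] p).2 - p.2) / n

/-- The fibred rotation set of a lift `F`. -/
def fibredRotationSet {Θ : Type*} (F : Θ × ℝ → Θ × ℝ) : Set ℝ :=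
  Set.range fun p : Θ × ℝ => limsup (fun n : ℕ => rotationQuotient F n p) atTop

/-- Minimal sets: nonempty closed invariant sets without proper nonempty closed invariant
subsets. -/
structure IsMinimalSet {X : Type*} [TopologicalSpace X] (f : X → X) (M : Set X) : Prop where
  isClosed : IsClosed M
  nonempty : M.Nonempty
  mapsTo : Set.MapsTo f M M
  eq_of_subset : ∀ N : Set X, N ⊆ M → IsClosed N → N.Nonempty → Set.MapsTo f N N → N = M

/-- Topological entropy of a self-map (Bowen's definition by covers with dynamical balls). -/
def topEntropy {X : Type*} [UniformSpace X] (T : X → X) : EReal :=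
  Dynamics.coverEntropy T Set.univ

end

theorem sub_eq_of_coe_unitAddCircle_eq {X : Type*} [TopologicalSpace X] [PreconnectedSpace X]
    {u v : X → ℝ} (hu : Continuous u) (hv : Continuous v)
    (h : ∀ x, (u x : UnitAddCircle) = (v x : UnitAddCircle)) (x y : X) :
    u x - v x = u y - v y := by
  have hmem : ∀ x, ((u x - v x : ℝ) : UnitAddCircle) = ((0 : ℝ) : UnitAddCircle) := fun x => by
    rw [AddCircle.coe_sub, h x, sub_self, AddCircle.coe_zero]
  exact (AddCircle.isCoveringMap_coe (1 : ℝ)).const_of_comp (hu.sub hv)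
    (fun a b => (hmem a).trans (hmem b).symm) x y

theorem IsLift.fst_apply {Θ : Type*} [TopologicalSpace Θ] {r : C(Θ, Θ)}
    {f : C(Θ × UnitAddCircle, Θ × UnitAddCircle)} (hf : IsSkewProductOver r f)
    {F : C(Θ × ℝ, Θ × ℝ)} (hF : IsLift F f) (p : Θ × ℝ) : (F p).1 = r p.1 := by
  have h := congrArg Prod.fst (hF p)
  rw [hf] at h
  exact h

theorem IsLift.snd_apply_add_one {Θ : Type*} [TopologicalSpace Θ] {r : C(Θ, Θ)}
    {f : C(Θ × UnitAddCircle, Θ × UnitAddCircle)} (hhom : IsHomotopicToId r f)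
    {F : C(Θ × ℝ, Θ × ℝ)} (hF : IsLift F f) (θ : Θ) (x : ℝ) :
    (F (θ, x + 1)).2 = (F (θ, x)).2 + 1 := by
  obtain ⟨h⟩ := hhom
  have hcoe : Continuous ((↑) : ℝ → UnitAddCircle) :=
    (AddCircle.isCoveringMap_coe (1 : ℝ)).continuous
  let H : C(unitInterval × ℝ, UnitAddCircle) :=
    ⟨fun q => (h (q.1, (θ, (q.2 : UnitAddCircle)))).2, by fun_prop⟩
  let g : C(ℝ, ℝ) := ⟨fun y => (F (θ, y)).2, by fun_prop⟩
  have H0 : ∀ a, H (0, a) = ((g a : ℝ) : UnitAddCircle) := fun a => by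
    have h1 := congrArg Prod.snd (hF (θ, a))
    simp only [circleProj] at h1
    simp [H, g, h1]
  let L := (AddCircle.isCoveringMap_coe (1 : ℝ)).liftHomotopy H g H0
  have hL : ∀ q, ((L q : ℝ) : UnitAddCircle) = H q :=
    congrFun ((AddCircle.isCoveringMap_coe (1 : ℝ)).liftHomotopy_lifts H g H0)
  have hL0 : ∀ a, L (0, a) = (F (θ, a)).2 :=
    (AddCircle.isCoveringMap_coe (1 : ℝ)).liftHomotopy_zero H g H0
  have e1 := sub_eq_of_coe_unitAddCircle_eq (X := unitInterval) (u := fun t => L (t, x + 1))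
    (v := fun t => L (t, x)) (by fun_prop) (by fun_prop)
    (fun t => by rw [hL, hL]; simp [H]) 0 1
  have e2 := sub_eq_of_coe_unitAddCircle_eq (X := ℝ) (u := fun y => L (1, y))
    (v := fun y => y) (by fun_prop) (by fun_prop)
    (fun y => by rw [hL]; simp [H]) (x + 1) x
  simp only [hL0] at e1 e2
  linarith

/-- The empirical measure of the orbit segment `x, T x, …, T^[n] x`. -/
noncomputable def empiricalMeasure {X : Type*} [MeasurableSpace X] (T : X → X) (n : ℕ) (x : X) :
    ProbabilityMeasure X :=
  ⟨((n + 1 : ℕ) : ENNReal)⁻¹ • ∑ k ∈ Finset.range (n + 1), Measure.dirac (T^[k] x), ⟨by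
    simp only [Measure.smul_apply, Measure.finsetSum_apply, measure_univ, Finset.sum_const,
      Finset.card_range, smul_eq_mul, nsmul_eq_mul, mul_one]
    exact ENNReal.inv_mul_cancel (by simp) (by simp)⟩⟩

theorem integral_empiricalMeasure {X : Type*} [TopologicalSpace X] [CompactSpace X]
    [TopologicalSpace.PseudoMetrizableSpace X]
    [MeasurableSpace X] [BorelSpace X] (T : X → X) (n : ℕ) (x : X) {g : X → ℝ}
    (hg : Continuous g) :
    ∫ y, g y ∂(empiricalMeasure T n x : Measure X) = birkhoffAverage ℝ T g (n + 1) x := by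
  change ∫ y, g y ∂(((n + 1 : ℕ) : ENNReal)⁻¹ •
    ∑ k ∈ Finset.range (n + 1), Measure.dirac (T^[k] x)) = _
  rw [integral_smul_measure, integral_finsetSum_measure]
  · simp only [integral_dirac' _ _ hg.stronglyMeasurable, ENNReal.toReal_inv,
      ENNReal.toReal_natCast, birkhoffAverage, birkhoffSum]
  · intro k _
    exact hg.integrable_of_hasCompactSupport (HasCompactSupport.of_compactSpace g)

theorem tendstoUniformly_birkhoffAverage_succ {X : Type*} [MetricSpace X] [CompactSpace X]
    [MeasurableSpace X] [BorelSpace X] {T : X → X} (hT : Continuous T) {μ : Measure X}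
    (huniq : ∀ ν : Measure X, IsProbabilityMeasure ν → MeasurePreserving T ν ν → ν = μ)
    {g : X → ℝ} (hg : Continuous g) :
    TendstoUniformly (fun n x => birkhoffAverage ℝ T g (n + 1) x) (fun _ => ∫ y, g y ∂μ)
      atTop := by
  rw [tendstoUniformly_iff_tendstoUniformlyOnFilter, tendstoUniformlyOnFilter_iff_tendsto]
  rw [tendsto_iff_ultrafilter]
  intro 𝒰 h𝒰
  obtain ⟨ν, -, hν⟩ := isCompact_univ.ultrafilter_le_nhds
    (𝒰.map fun q : ℕ × X => empiricalMeasure T q.1 q.2) (by simp)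
  have hν' : Tendsto (fun q : ℕ × X => empiricalMeasure T q.1 q.2) 𝒰 (𝓝 ν) := hν
  have hlim : ∀ g : BoundedContinuousFunction X ℝ,
      Tendsto (fun q : ℕ × X => birkhoffAverage ℝ T g (q.1 + 1) q.2) 𝒰
        (𝓝 (∫ y, g y ∂(ν : Measure X))) := fun g => by
    have := ProbabilityMeasure.tendsto_iff_forall_integral_tendsto.1 hν' g
    simpa only [integral_empiricalMeasure T _ _ g.continuous] using this
  have hfst : Tendsto Prod.fst (𝒰 : Filter (ℕ × X)) atTop := tendsto_fst.mono_left h𝒰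
  have hinv : MeasurePreserving T (ν : Measure X) ν := by
    refine ⟨hT.measurable, ?_⟩
    have : IsProbabilityMeasure ((ν : Measure X).map T) :=
      Measure.isProbabilityMeasure_map hT.aemeasurable
    refine ext_of_forall_integral_eq_of_IsFiniteMeasure fun g => ?_
    rw [integral_map hT.aemeasurable g.continuous.aestronglyMeasurable]
    have h1 := hlim (g.compContinuous ⟨T, hT⟩)
    refine tendsto_nhds_unique (f := fun q : ℕ × X => birkhoffAverage ℝ T g (q.1 + 1) (T q.2)) ?_ ?_
      (l := (𝒰 : Filter (ℕ × X)))
    · refine h1.congr fun q => ?_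
      simp only [birkhoffAverage, birkhoffSum, BoundedContinuousFunction.compContinuous_apply,
        ContinuousMap.coe_mk]
      simp only [← Function.iterate_succ_apply, ← Function.iterate_succ_apply']
    · have h2 : Tendsto (fun q : ℕ × X => birkhoffAverage ℝ T g (q.1 + 1) (T q.2) -
          birkhoffAverage ℝ T g (q.1 + 1) q.2) 𝒰 (𝓝 0) := by
        have h3 : Tendsto (fun q : ℕ × X => (((q.1 + 1 : ℕ) : ℝ))⁻¹ * (2 * ‖g‖)) 𝒰 (𝓝 0) := by
          have : Tendsto (fun n : ℕ => (((n + 1 : ℕ) : ℝ))⁻¹ * (2 * ‖g‖)) atTop (𝓝 0) := by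
            simpa using ((tendsto_inv_atTop_zero.comp
              (tendsto_natCast_atTop_atTop (R := ℝ))).comp (tendsto_add_atTop_nat 1)).mul_const
              (2 * ‖g‖)
          exact this.comp hfst
        refine squeeze_zero_norm (fun q => ?_) h3
        rw [birkhoffAverage_apply_sub_birkhoffAverage, norm_smul, norm_inv, RCLike.norm_natCast]
        gcongr
        calc ‖g (T^[q.1 + 1] q.2) - g q.2‖ ≤ ‖g (T^[q.1 + 1] q.2)‖ + ‖g q.2‖ := norm_sub_le _ _
          _ ≤ 2 * ‖g‖ := by linarith [g.norm_coe_le_norm (T^[q.1 + 1] q.2), g.norm_coe_le_norm q.2]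
      simpa using h2.add (hlim g)
  have hνμ : (ν : Measure X) = μ := huniq _ inferInstance hinv
  have h4 := hlim (BoundedContinuousFunction.mkOfCompact ⟨g, hg⟩)
  rw [hνμ] at h4
  exact tendsto_left_nhds_uniformity.comp h4

theorem tendstoUniformly_birkhoffAverage {X : Type*} [MetricSpace X] [CompactSpace X]
    [MeasurableSpace X] [BorelSpace X] {T : X → X} (hT : Continuous T) {μ : Measure X}
    (huniq : ∀ ν : Measure X, IsProbabilityMeasure ν → MeasurePreserving T ν ν → ν = μ)
    {g : X → ℝ} (hg : Continuous g) :
    TendstoUniformly (fun n x => birkhoffAverage ℝ T g n x) (fun _ => ∫ y, g y ∂μ) atTop := by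
  intro u hu
  have h := tendstoUniformly_birkhoffAverage_succ hT huniq hg u hu
  obtain ⟨N, hN⟩ := eventually_atTop.1 h
  refine eventually_atTop.2 ⟨N + 1, fun n hn x => ?_⟩
  obtain ⟨k, rfl⟩ := Nat.exists_eq_add_of_le' (Nat.one_le_of_lt hn)
  exact hN k (by omega) x

/-- `G` is the fibre coordinate of a lift of a fibrewise degree one skew product. -/
structure IsDegreeOneLift {Θ : Type*} [TopologicalSpace Θ] (G : Θ × ℝ → ℝ) : Prop where
  continuous : Continuous G
  apply_add_one : ∀ θ x, G (θ, x + 1) = G (θ, x) + 1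

/-- A degree one lift that is nondecreasing on fibres. -/
structure IsMonotoneLift {Θ : Type*} [TopologicalSpace Θ] (G : Θ × ℝ → ℝ) : Prop extends
    IsDegreeOneLift G where
  monotone : ∀ θ, Monotone fun x => G (θ, x)

/-- The skew product over `r` with fibre coordinate `G`. -/
def skewProduct {Θ : Type*} (r : Θ → Θ) (G : Θ × ℝ → ℝ) (p : Θ × ℝ) : Θ × ℝ :=
  (r p.1, G p)

section

variable {Θ : Type*}

theorem skewProduct_iterate_fst (r : Θ → Θ) (G : Θ × ℝ → ℝ) (n : ℕ) (p : Θ × ℝ) :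
    ((skewProduct r G)^[n] p).1 = r^[n] p.1 := by
  induction n generalizing p with
  | zero => rfl
  | succ n ih => simp only [Function.iterate_succ_apply, ih]; rfl

theorem skewProduct_iterate_succ_snd (r : Θ → Θ) (G : Θ × ℝ → ℝ) (n : ℕ) (p : Θ × ℝ) :
    ((skewProduct r G)^[n + 1] p).2 = G ((skewProduct r G)^[n] p) := by
  rw [Function.iterate_succ_apply']; rfl

theorem skewProduct_iterate_le {r : Θ → Θ} {G H : Θ × ℝ → ℝ} (hGH : ∀ p, G p ≤ H p)
    (hmono : (∀ θ, Monotone fun x => G (θ, x)) ∨ ∀ θ, Monotone fun x => H (θ, x))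
    (n : ℕ) (p : Θ × ℝ) : ((skewProduct r G)^[n] p).2 ≤ ((skewProduct r H)^[n] p).2 := by
  induction n with
  | zero => exact le_rfl
  | succ n ih =>
    simp only [skewProduct_iterate_succ_snd]
    have hG : (skewProduct r G)^[n] p = (r^[n] p.1, ((skewProduct r G)^[n] p).2) := by
      rw [← skewProduct_iterate_fst r G n p]
    have hH : (skewProduct r H)^[n] p = (r^[n] p.1, ((skewProduct r H)^[n] p).2) := by
      rw [← skewProduct_iterate_fst r H n p]
    rw [hG, hH]
    rcases hmono with h | h
    · exact (h _ ih).trans (hGH _)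
    · exact (hGH _).trans (h _ ih)

theorem iterate_eq_of_forall_iterate_eq {r : Θ → Θ} {G H : Θ × ℝ → ℝ} {p : Θ × ℝ}
    (h : ∀ n, H ((skewProduct r G)^[n] p) = G ((skewProduct r G)^[n] p)) (n : ℕ) :
    (skewProduct r H)^[n] p = (skewProduct r G)^[n] p := by
  induction n with
  | zero => rfl
  | succ n ih =>
    rw [Function.iterate_succ_apply', Function.iterate_succ_apply', ih]
    exact Prod.ext rfl (h n)

variable [TopologicalSpace Θ]

theorem continuous_skewProduct_iterate {r : Θ → Θ} {G : Θ × ℝ → ℝ} (hr : Continuous r)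
    (hG : Continuous G) (n : ℕ) : Continuous (skewProduct r G)^[n] :=
  Continuous.iterate ((hr.comp continuous_fst).prodMk hG) n

namespace IsDegreeOneLift

variable {G : Θ × ℝ → ℝ}

theorem apply_add_int (hG : IsDegreeOneLift G) (θ : Θ) (x : ℝ) (k : ℤ) :
    G (θ, x + k) = G (θ, x) + k := by
  induction k using Int.induction_on with
  | zero => simp
  | succ n ih =>
    push_cast at ih ⊢
    rw [← add_assoc, hG.apply_add_one, ih, add_assoc]
  | pred n ih =>
    have := hG.apply_add_one θ (x + ((-(n : ℤ) - 1 : ℤ) : ℝ))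
    have h2 : x + ((-(n : ℤ) - 1 : ℤ) : ℝ) + 1 = x + ((-(n : ℤ) : ℤ) : ℝ) := by push_cast; ring
    rw [h2, ih] at this
    push_cast at this ⊢
    linarith

theorem iterate (hG : IsDegreeOneLift G) {r : Θ → Θ} (hr : Continuous r) (n : ℕ) :
    IsDegreeOneLift fun p => ((skewProduct r G)^[n] p).2 where
  continuous := continuous_snd.comp (continuous_skewProduct_iterate hr hG.continuous n)
  apply_add_one θ x := by
    induction n with
    | zero => rfl
    | succ n ih =>
      simp only [skewProduct_iterate_succ_snd]
      have h1 : (skewProduct r G)^[n] (θ, x + 1) =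
          (((skewProduct r G)^[n] (θ, x)).1, ((skewProduct r G)^[n] (θ, x)).2 + 1) := by
        ext
        · simp [skewProduct_iterate_fst]
        · exact ih
      rw [h1, hG.apply_add_one]

end IsDegreeOneLift

namespace IsMonotoneLift

variable {G : Θ × ℝ → ℝ}

theorem iterate (hG : IsMonotoneLift G) {r : Θ → Θ} (hr : Continuous r) (n : ℕ) :
    IsMonotoneLift fun p => ((skewProduct r G)^[n] p).2 where
  toIsDegreeOneLift := hG.toIsDegreeOneLift.iterate hr n
  monotone θ := by
    induction n with
    | zero => exact monotone_id
    | succ n ih =>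
      intro x y hxy
      simp only [skewProduct_iterate_succ_snd]
      have h1 : ∀ z, (skewProduct r G)^[n] (θ, z) =
          (r^[n] θ, ((skewProduct r G)^[n] (θ, z)).2) := fun z => by
        ext
        · simp [skewProduct_iterate_fst]
        · rfl
      rw [h1 x, h1 y]
      exact hG.monotone _ (ih hxy)

theorem abs_displacement_sub_le (hG : IsMonotoneLift G) (θ : Θ) (x y : ℝ) :
    |(G (θ, x) - x) - (G (θ, y) - y)| ≤ 1 := by
  have h1 : G (θ, y + (⌊x - y⌋ : ℤ)) ≤ G (θ, x) :=
    hG.monotone θ (by linarith [Int.floor_le (x - y)])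
  have h2 : G (θ, x) ≤ G (θ, y + (⌊x - y⌋ + 1 : ℤ)) :=
    hG.monotone θ (by push_cast; linarith [Int.lt_floor_add_one (x - y)])
  rw [hG.apply_add_int] at h1 h2
  push_cast at h2
  rw [abs_le]
  constructor <;> linarith [Int.floor_le (x - y), Int.lt_floor_add_one (x - y)]

theorem exists_abs_displacement_le [CompactSpace Θ] (hG : IsMonotoneLift G) :
    ∃ C, ∀ p, |G p - p.2| ≤ C := by
  obtain ⟨C, hC⟩ := isCompact_univ.exists_bound_of_continuousOn
    (f := fun θ : Θ => G (θ, 0)) (by have := hG.continuous; fun_prop)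
  refine ⟨C + 1, fun ⟨θ, x⟩ => ?_⟩
  have h1 := hG.abs_displacement_sub_le θ x 0
  have h2 := hC θ trivial
  rw [Real.norm_eq_abs] at h2
  rw [abs_le] at *
  constructor <;> linarith

variable {r : Θ → Θ}

theorem abs_sub_birkhoffSum_le (hr : Continuous r) (hG : IsMonotoneLift G) {C : ℝ}
    (hC : ∀ p, |G p - p.2| ≤ C) (m n : ℕ) (p : Θ × ℝ) :
    |m * (((skewProduct r G)^[n] p).2 - p.2) -
      birkhoffSum r (fun θ => ((skewProduct r G)^[m] (θ, 0)).2) n p.1| ≤ n + 2 * m ^ 2 * C := by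
  set D : ℕ → ℝ := fun j => ((skewProduct r G)^[j] p).2 with hD
  have hC0 : 0 ≤ C := (abs_nonneg _).trans (hC p)
  have hstep : ∀ i j, |D (i + j) - D i| ≤ j * C := fun i j => by
    induction j with
    | zero => simp
    | succ j ih =>
      have h1 : |D (i + j + 1) - D (i + j)| ≤ C := by
        simp only [hD, skewProduct_iterate_succ_snd]; exact hC _
      have := abs_sub_le (D (i + j + 1)) (D (i + j)) (D i)
      rw [← add_assoc]
      push_cast
      linarith
  have hadd : ∀ k, |(D (k + m) - D k) - ((skewProduct r G)^[m] (r^[k] p.1, 0)).2| ≤ 1 := fun k => by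
    have := (hG.iterate hr m).abs_displacement_sub_le (r^[k] p.1) (D k) 0
    have h2 : (r^[k] p.1, D k) = (skewProduct r G)^[k] p := by
      rw [← skewProduct_iterate_fst r G k p]
    rw [h2, ← Function.iterate_add_apply, add_comm m k, sub_zero] at this
    exact this
  have hsum : ∀ n, ∑ k ∈ Finset.range n, (D (k + m) - D k) =
      ∑ j ∈ Finset.range m, (D (n + j) - D j) := fun n => by
    induction n with
    | zero => simp
    | succ n ih =>
      rw [Finset.sum_range_succ, ih]
      have h3 := Finset.sum_range_sub (fun j => D (n + j)) m
      have h4 : ∑ j ∈ Finset.range m, (D (n + 1 + j) - D j) =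
        ∑ j ∈ Finset.range m, (D (n + j) - D j) +
          ∑ j ∈ Finset.range m, (D (n + (j + 1)) - D (n + j)) := by
        rw [← Finset.sum_add_distrib]
        refine Finset.sum_congr rfl fun j _ => ?_
        rw [show n + 1 + j = n + (j + 1) by ring]; ring
      rw [h4, h3]; simp
  have hA : |∑ k ∈ Finset.range n, (D (k + m) - D k) -
      birkhoffSum r (fun θ => ((skewProduct r G)^[m] (θ, 0)).2) n p.1| ≤ n := by
    rw [birkhoffSum, ← Finset.sum_sub_distrib]
    refine (Finset.abs_sum_le_sum_abs _ _).trans ?_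
    refine (Finset.sum_le_sum fun k _ => hadd k).trans ?_
    simp
  have hB : |m * (D n - D 0) - ∑ j ∈ Finset.range m, (D (n + j) - D j)| ≤ 2 * m ^ 2 * C := by
    have h5 : m * (D n - D 0) - ∑ j ∈ Finset.range m, (D (n + j) - D j) =
        ∑ j ∈ Finset.range m, ((D (0 + j) - D 0) - (D (n + j) - D n)) := by
      simp only [Finset.sum_sub_distrib, Finset.sum_const, Finset.card_range, nsmul_eq_mul,
        zero_add]
      ring
    rw [h5]
    refine (Finset.abs_sum_le_sum_abs _ _).trans ?_
    have h6 : ∀ j ∈ Finset.range m, |(D (0 + j) - D 0) - (D (n + j) - D n)| ≤ 2 * m * C := by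
      intro j hj
      have hjm : (j : ℝ) * C ≤ m * C :=
        mul_le_mul_of_nonneg_right (by exact_mod_cast (Finset.mem_range.1 hj).le) hC0
      have h7 := abs_sub (D (0 + j) - D 0) (D (n + j) - D n)
      linarith [hstep 0 j, hstep n j]
    refine (Finset.sum_le_sum h6).trans (le_of_eq ?_)
    simp only [Finset.sum_const, Finset.card_range, nsmul_eq_mul]
    ring
  rw [hsum] at hA
  have := abs_sub_le (m * (D n - D 0)) (∑ j ∈ Finset.range m, (D (n + j) - D j))
    (birkhoffSum r (fun θ => ((skewProduct r G)^[m] (θ, 0)).2) n p.1)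
  have hD0 : D 0 = p.2 := rfl
  rw [hD0] at this hB
  linarith

end IsMonotoneLift

end

section

variable {Θ : Type*} [MetricSpace Θ] [CompactSpace Θ] [MeasurableSpace Θ] [BorelSpace Θ]
  {r : Θ → Θ} {μ : Measure Θ}

theorem IsMonotoneLift.eventually_abs_rotationQuotient_sub_le {G : Θ × ℝ → ℝ}
    (hG : IsMonotoneLift G) (hr : Continuous r)
    (huniq : ∀ ν : Measure Θ, IsProbabilityMeasure ν → MeasurePreserving r ν ν → ν = μ)
    {m : ℕ} (hm : 0 < m) :
    ∀ᶠ n in atTop, ∀ p, |rotationQuotient (skewProduct r G) n p -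
      (∫ θ, ((skewProduct r G)^[m] (θ, 0)).2 ∂μ) / m| ≤ 3 / m := by
  obtain ⟨C, hC⟩ := hG.exists_abs_displacement_le
  have hcont : Continuous fun θ => ((skewProduct r G)^[m] (θ, 0)).2 := by
    have := (hG.iterate hr m).continuous
    exact this.comp (by fun_prop : Continuous fun θ : Θ => (θ, (0 : ℝ)))
  have h1 := Metric.tendstoUniformly_iff.1 (tendstoUniformly_birkhoffAverage hr huniq hcont) 1
    one_pos
  have hm' : (0 : ℝ) < m := by exact_mod_cast hm
  have h2 : ∀ᶠ n : ℕ in atTop, 2 * m ^ 2 * C ≤ n :=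
    (tendsto_natCast_atTop_atTop (R := ℝ)).eventually_ge_atTop _
  filter_upwards [h1, h2, eventually_gt_atTop 0] with n hn1 hn2 hn p
  have hn' : (0 : ℝ) < n := by exact_mod_cast hn
  have h3 := hG.abs_sub_birkhoffSum_le hr hC m n p
  have h4 := hn1 p.1
  rw [Real.dist_eq, birkhoffAverage, smul_eq_mul] at h4
  set I := ∫ θ, ((skewProduct r G)^[m] (θ, 0)).2 ∂μ
  set B := birkhoffSum r (fun θ => ((skewProduct r G)^[m] (θ, 0)).2) n p.1
  set d := ((skewProduct r G)^[n] p).2 - p.2 with hd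
  have h5 : rotationQuotient (skewProduct r G) n p - I / m =
      ((m * d - B) / n + ((n : ℝ)⁻¹ * B - I)) / m := by
    rw [rotationQuotient, ← hd]; field_simp; ring
  rw [h5, abs_div, abs_of_pos hm']
  gcongr
  have h6 : |(m * d - B) / n| ≤ 2 := by
    rw [abs_div, abs_of_pos hn', div_le_iff₀ hn']; linarith
  have h7 := abs_add_le ((m * d - B) / n) ((n : ℝ)⁻¹ * B - I)
  rw [abs_sub_comm] at h4
  linarith

theorem IsMonotoneLift.exists_tendstoUniformly_rotationQuotient [Nonempty Θ] {G : Θ × ℝ → ℝ}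
    (hG : IsMonotoneLift G) (hr : Continuous r)
    (huniq : ∀ ν : Measure Θ, IsProbabilityMeasure ν → MeasurePreserving r ν ν → ν = μ) :
    ∃ ρ : ℝ, TendstoUniformly (rotationQuotient (skewProduct r G)) (fun _ => ρ) atTop ∧
      ∀ m : ℕ, 0 < m → |ρ - (∫ θ, ((skewProduct r G)^[m] (θ, 0)).2 ∂μ) / m| ≤ 3 / m := by
  set J : ℕ → ℝ := fun m => (∫ θ, ((skewProduct r G)^[m] (θ, 0)).2 ∂μ) / m with hJ
  have key : ∀ m : ℕ, 0 < m → ∀ᶠ n in atTop, ∀ p,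
      |rotationQuotient (skewProduct r G) n p - J m| ≤ 3 / m := fun m hm =>
    hG.eventually_abs_rotationQuotient_sub_le hr huniq hm
  obtain ⟨θ₀⟩ := ‹Nonempty Θ›
  have hlim : Tendsto (fun m : ℕ => (3 : ℝ) / m) atTop (𝓝 0) :=
    tendsto_const_div_atTop_nhds_zero_nat 3
  have hcau : CauchySeq fun n => rotationQuotient (skewProduct r G) n (θ₀, 0) := by
    rw [Metric.cauchySeq_iff]
    intro ε hε
    obtain ⟨m, hm, hm0⟩ := ((hlim.eventually (gt_mem_nhds (half_pos hε))).and
      (eventually_gt_atTop 0)).exists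
    obtain ⟨N, hN⟩ := eventually_atTop.1 (key m hm0)
    refine ⟨N, fun i hi j hj => ?_⟩
    have h1 := hN i hi (θ₀, 0)
    have h2 := hN j hj (θ₀, 0)
    rw [Real.dist_eq]
    rw [abs_le] at h1 h2
    rw [abs_lt]
    constructor <;> linarith
  obtain ⟨ρ, hρ⟩ := cauchySeq_tendsto_of_complete hcau
  have hρJ : ∀ m : ℕ, 0 < m → |ρ - J m| ≤ 3 / m := fun m hm =>
    le_of_tendsto (hρ.sub_const _).abs ((key m hm).mono fun n hn => hn (θ₀, 0))
  refine ⟨ρ, ?_, hρJ⟩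
  rw [Metric.tendstoUniformly_iff]
  intro ε hε
  obtain ⟨m, hm, hm0⟩ := ((hlim.eventually (gt_mem_nhds (half_pos hε))).and
    (eventually_gt_atTop 0)).exists
  filter_upwards [key m hm0] with n hn p
  have h1 := hn p
  have h2 := hρJ m hm0
  rw [Real.dist_eq]
  rw [abs_le] at h1 h2
  rw [abs_lt]
  constructor <;> linarith

/-- For a continuous family of monotone lifts, the rotation numbers depend continuously on the
parameter. -/
theorem exists_continuous_rotationNumber [Nonempty Θ] [IsProbabilityMeasure μ]
    {A : Type*} [TopologicalSpace A] [FirstCountableTopology A] [LocallyCompactSpace A]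
    {H : A → Θ × ℝ → ℝ} (hH : ∀ t, IsMonotoneLift (H t))
    (hcont : Continuous fun q : A × (Θ × ℝ) => H q.1 q.2) (hr : Continuous r)
    (huniq : ∀ ν : Measure Θ, IsProbabilityMeasure ν → MeasurePreserving r ν ν → ν = μ) :
    ∃ ρ : A → ℝ, Continuous ρ ∧
      ∀ t, TendstoUniformly (rotationQuotient (skewProduct r (H t))) (fun _ => ρ t) atTop := by
  choose ρ hρ hρJ using fun t => (hH t).exists_tendstoUniformly_rotationQuotient hr huniq
  refine ⟨ρ, ?_, hρ⟩
  have hiter : ∀ m : ℕ, Continuous fun q : A × (Θ × ℝ) => (skewProduct r (H q.1))^[m] q.2 := by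
    intro m
    induction m with
    | zero => exact continuous_snd
    | succ m ih =>
      simp only [Function.iterate_succ_apply']
      exact (hr.comp (continuous_fst.comp ih)).prodMk (hcont.comp (continuous_fst.prodMk ih))
  have hI : ∀ m : ℕ, Continuous fun t => (∫ θ, ((skewProduct r (H t))^[m] (θ, 0)).2 ∂μ) / m := by
    intro m
    refine Continuous.div_const ?_ _
    have h1 : Continuous fun q : A × Θ => ((skewProduct r (H q.1))^[m] (q.2, 0)).2 :=
      continuous_snd.comp ((hiter m).comp
        (continuous_fst.prodMk (continuous_snd.prodMk continuous_const)))
    have h2 := continuous_parametric_integral_of_continuous (μ := μ)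
      (f := fun t θ => ((skewProduct r (H t))^[m] (θ, 0)).2) h1 isCompact_univ
    simpa using h2
  refine TendstoUniformly.continuous (p := atTop)
    (F := fun (m : ℕ) t => (∫ θ, ((skewProduct r (H t))^[m] (θ, 0)).2 ∂μ) / m) ?_
    (Frequently.of_forall hI)
  rw [Metric.tendstoUniformly_iff]
  intro ε hε
  have hlim : Tendsto (fun m : ℕ => (3 : ℝ) / m) atTop (𝓝 0) :=
    tendsto_const_div_atTop_nhds_zero_nat 3
  filter_upwards [hlim.eventually (gt_mem_nhds hε), eventually_gt_atTop 0] with m hm hm0 t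
  rw [Real.dist_eq]
  exact (hρJ t m hm0).trans_lt hm

end

/-- The largest fibrewise nondecreasing minorant of a degree one lift. -/
noncomputable def lowerEnvelope {Θ : Type*} (G : Θ × ℝ → ℝ) (p : Θ × ℝ) : ℝ :=
  sInf ((fun s => G (p.1, p.2 + s)) '' Set.Icc 0 1)

/-- The smallest fibrewise nondecreasing majorant of a degree one lift. -/
noncomputable def upperEnvelope {Θ : Type*} (G : Θ × ℝ → ℝ) (p : Θ × ℝ) : ℝ :=
  sSup ((fun s => G (p.1, p.2 - s)) '' Set.Icc 0 1)

/-- The monotone lift obtained from `G` by truncating at height `t` above its lower envelope and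
taking the upper envelope. -/
noncomputable def truncatedEnvelope {Θ : Type*} (G : Θ × ℝ → ℝ) (t : ℝ) : Θ × ℝ → ℝ :=
  upperEnvelope fun p => min (G p) (lowerEnvelope G p + t)

section

variable {Θ : Type*} [TopologicalSpace Θ] {G : Θ × ℝ → ℝ}

theorem continuous_lowerEnvelope {A : Type*} [TopologicalSpace A] {G : A → Θ × ℝ → ℝ}
    (hG : Continuous fun q : A × (Θ × ℝ) => G q.1 q.2) :
    Continuous fun q : A × (Θ × ℝ) => lowerEnvelope (G q.1) q.2 :=
  isCompact_Icc.continuous_sInf (f := fun (q : A × (Θ × ℝ)) s => G q.1 (q.2.1, q.2.2 + s))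
    (hG.comp (by fun_prop :
      Continuous fun u : (A × (Θ × ℝ)) × ℝ => (u.1.1, (u.1.2.1, u.1.2.2 + u.2))))

theorem continuous_upperEnvelope {A : Type*} [TopologicalSpace A] {G : A → Θ × ℝ → ℝ}
    (hG : Continuous fun q : A × (Θ × ℝ) => G q.1 q.2) :
    Continuous fun q : A × (Θ × ℝ) => upperEnvelope (G q.1) q.2 :=
  isCompact_Icc.continuous_sSup (f := fun (q : A × (Θ × ℝ)) s => G q.1 (q.2.1, q.2.2 - s))
    (hG.comp (by fun_prop :
      Continuous fun u : (A × (Θ × ℝ)) × ℝ => (u.1.1, (u.1.2.1, u.1.2.2 - u.2))))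

namespace IsDegreeOneLift

theorem continuousOn_fibre (hG : IsDegreeOneLift G) (θ : Θ) {h : ℝ → ℝ} (hh : Continuous h)
    (S : Set ℝ) : ContinuousOn (fun s => G (θ, h s)) S :=
  (hG.continuous.comp (continuous_const.prodMk hh)).continuousOn

theorem lowerEnvelope_le (hG : IsDegreeOneLift G) (θ : Θ) {x y : ℝ} (hxy : x ≤ y) :
    lowerEnvelope G (θ, x) ≤ G (θ, y) := by
  have hcpt := (isCompact_Icc (a := (0 : ℝ)) (b := 1)).image_of_continuousOn
    (hG.continuousOn_fibre θ (continuous_const.add continuous_id : Continuous fun s => x + s) _)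
  have h1 : lowerEnvelope G (θ, x) ≤ G (θ, x + Int.fract (y - x)) :=
    csInf_le hcpt.bddBelow ⟨_, ⟨Int.fract_nonneg _, (Int.fract_lt_one _).le⟩, rfl⟩
  have h2 : y = x + Int.fract (y - x) + (⌊y - x⌋ : ℤ) := by
    linarith [Int.fract_add_floor (y - x)]
  rw [h2, hG.apply_add_int]
  have h3 : (0 : ℝ) ≤ (⌊y - x⌋ : ℤ) := by
    exact_mod_cast Int.floor_nonneg.2 (sub_nonneg.2 hxy)
  linarith

theorem exists_lowerEnvelope_eq (hG : IsDegreeOneLift G) (θ : Θ) (x : ℝ) :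
    ∃ y, x ≤ y ∧ lowerEnvelope G (θ, x) = G (θ, y) := by
  obtain ⟨s, hs, h⟩ := (isCompact_Icc (a := (0 : ℝ)) (b := 1)).exists_sInf_image_eq
    ⟨0, by simp⟩
    (hG.continuousOn_fibre θ (continuous_const.add continuous_id : Continuous fun s => x + s) _)
  exact ⟨x + s, by linarith [hs.1], h⟩

theorem isMonotoneLift_lowerEnvelope (hG : IsDegreeOneLift G) :
    IsMonotoneLift (lowerEnvelope G) where
  continuous := (continuous_lowerEnvelope (A := Unit) (G := fun _ => G)
    (hG.continuous.comp continuous_snd)).comp (continuous_const.prodMk continuous_id :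
      Continuous fun p : Θ × ℝ => ((), p))
  apply_add_one θ x := by
    apply le_antisymm
    · obtain ⟨y, hy, h⟩ := hG.exists_lowerEnvelope_eq θ x
      rw [h, ← hG.apply_add_one]
      exact hG.lowerEnvelope_le θ (by linarith)
    · obtain ⟨y, hy, h⟩ := hG.exists_lowerEnvelope_eq θ (x + 1)
      have h1 := hG.lowerEnvelope_le θ (show x ≤ y - 1 by linarith)
      have h2 := hG.apply_add_one θ (y - 1)
      rw [sub_add_cancel] at h2
      linarith
  monotone θ x x' hx := by
    obtain ⟨y, hy, h⟩ := hG.exists_lowerEnvelope_eq θ x'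
    simp only [h]
    exact hG.lowerEnvelope_le θ (hx.trans hy)

theorem le_upperEnvelope (hG : IsDegreeOneLift G) (θ : Θ) {x y : ℝ} (hyx : y ≤ x) :
    G (θ, y) ≤ upperEnvelope G (θ, x) := by
  have hcpt := (isCompact_Icc (a := (0 : ℝ)) (b := 1)).image_of_continuousOn
    (hG.continuousOn_fibre θ (continuous_const.sub continuous_id : Continuous fun s => x - s) _)
  have h1 : G (θ, x - Int.fract (x - y)) ≤ upperEnvelope G (θ, x) :=
    le_csSup hcpt.bddAbove ⟨_, ⟨Int.fract_nonneg _, (Int.fract_lt_one _).le⟩, rfl⟩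
  have h2 : x - Int.fract (x - y) = y + (⌊x - y⌋ : ℤ) := by
    linarith [Int.fract_add_floor (x - y)]
  rw [h2, hG.apply_add_int] at h1
  have h3 : (0 : ℝ) ≤ (⌊x - y⌋ : ℤ) := by
    exact_mod_cast Int.floor_nonneg.2 (sub_nonneg.2 hyx)
  linarith

theorem exists_upperEnvelope_eq (hG : IsDegreeOneLift G) (θ : Θ) (x : ℝ) :
    ∃ y, y ≤ x ∧ upperEnvelope G (θ, x) = G (θ, y) := by
  obtain ⟨s, hs, h⟩ := (isCompact_Icc (a := (0 : ℝ)) (b := 1)).exists_sSup_image_eq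
    ⟨0, by simp⟩
    (hG.continuousOn_fibre θ (continuous_const.sub continuous_id : Continuous fun s => x - s) _)
  exact ⟨x - s, by linarith [hs.1], h⟩

theorem isMonotoneLift_upperEnvelope (hG : IsDegreeOneLift G) :
    IsMonotoneLift (upperEnvelope G) where
  continuous := (continuous_upperEnvelope (A := Unit) (G := fun _ => G)
    (hG.continuous.comp continuous_snd)).comp (continuous_const.prodMk continuous_id :
      Continuous fun p : Θ × ℝ => ((), p))
  apply_add_one θ x := by
    apply le_antisymm
    · obtain ⟨y, hy, h⟩ := hG.exists_upperEnvelope_eq θ (x + 1)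
      have h1 := hG.le_upperEnvelope θ (show y - 1 ≤ x by linarith)
      have h2 := hG.apply_add_one θ (y - 1)
      rw [sub_add_cancel] at h2
      linarith
    · obtain ⟨y, hy, h⟩ := hG.exists_upperEnvelope_eq θ x
      rw [h, ← hG.apply_add_one]
      exact hG.le_upperEnvelope θ (by linarith)
  monotone θ x x' hx := by
    obtain ⟨y, hy, h⟩ := hG.exists_upperEnvelope_eq θ x
    simp only [h]
    exact hG.le_upperEnvelope θ (hy.trans hx)

theorem truncation (hG : IsDegreeOneLift G) (t : ℝ) :
    IsDegreeOneLift fun p => min (G p) (lowerEnvelope G p + t) where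
  continuous := hG.continuous.min
    (hG.isMonotoneLift_lowerEnvelope.continuous.add continuous_const)
  apply_add_one θ x := by
    rw [hG.apply_add_one, hG.isMonotoneLift_lowerEnvelope.apply_add_one, add_right_comm,
      min_add_add_right]

theorem isMonotoneLift_truncatedEnvelope (hG : IsDegreeOneLift G) (t : ℝ) :
    IsMonotoneLift (truncatedEnvelope G t) :=
  (hG.truncation t).isMonotoneLift_upperEnvelope

theorem continuous_truncatedEnvelope (hG : IsDegreeOneLift G) :
    Continuous fun q : ℝ × (Θ × ℝ) => truncatedEnvelope G q.1 q.2 :=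
  continuous_upperEnvelope (G := fun t p => min (G p) (lowerEnvelope G p + t)) <|
    (hG.continuous.comp continuous_snd).min
      ((hG.isMonotoneLift_lowerEnvelope.continuous.comp continuous_snd).add continuous_fst)

theorem truncatedEnvelope_zero_le (hG : IsDegreeOneLift G) (p : Θ × ℝ) :
    truncatedEnvelope G 0 p ≤ G p := by
  obtain ⟨θ, x⟩ := p
  obtain ⟨y, hy, h⟩ := (hG.truncation 0).exists_upperEnvelope_eq θ x
  rw [truncatedEnvelope, h]
  exact (min_le_right _ _).trans (by simpa using hG.lowerEnvelope_le θ hy)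

theorem exists_le_truncatedEnvelope [CompactSpace Θ] (hG : IsDegreeOneLift G) :
    ∃ t, 0 ≤ t ∧ ∀ p, G p ≤ truncatedEnvelope G t p := by
  have hlow := hG.isMonotoneLift_lowerEnvelope
  obtain ⟨C, hC⟩ := (isCompact_univ.prod (isCompact_Icc (a := (0 : ℝ)) (b := 1))
    : IsCompact ((Set.univ : Set Θ) ×ˢ Set.Icc (0 : ℝ) 1)).exists_bound_of_continuousOn
    (f := fun p => G p - lowerEnvelope G p) (hG.continuous.sub hlow.continuous).continuousOn
  refine ⟨|C|, abs_nonneg C, fun ⟨θ, x⟩ => ?_⟩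
  refine le_trans (le_min le_rfl ?_) ((hG.truncation _).le_upperEnvelope θ le_rfl)
  have h1 := hC (θ, Int.fract x) ⟨trivial, Int.fract_nonneg _, (Int.fract_lt_one _).le⟩
  rw [Real.norm_eq_abs] at h1
  have h2 := hG.apply_add_int θ (Int.fract x) ⌊x⌋
  have h3 := hlow.apply_add_int θ (Int.fract x) ⌊x⌋
  rw [Int.fract_add_floor] at h2 h3
  linarith [le_abs_self C, le_abs_self (G (θ, Int.fract x) - lowerEnvelope G (θ, Int.fract x))]

end IsDegreeOneLift

theorem IsMonotoneLift.exists_apply_eq (hG : IsMonotoneLift G) (θ : Θ) (y : ℝ) :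
    ∃ x, G (θ, x) = y := by
  have hc : ContinuousOn (fun x => G (θ, x)) Set.univ :=
    hG.continuousOn_fibre θ continuous_id _
  have h1 : ∀ k : ℤ, G (θ, k) = G (θ, 0) + k := fun k => by
    simpa using hG.apply_add_int θ 0 k
  obtain ⟨x, -, hx⟩ := isPreconnected_univ.intermediate_value
    (Set.mem_univ ((⌊y - G (θ, 0)⌋ : ℤ) : ℝ)) (Set.mem_univ ((⌊y - G (θ, 0)⌋ + 1 : ℤ) : ℝ)) hc
    (show y ∈ Set.Icc _ _ from by
      simp only [h1]
      push_cast
      constructor <;> linarith [Int.floor_le (y - G (θ, 0)), Int.lt_floor_add_one (y - G (θ, 0))])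
  exact ⟨x, hx⟩

/-- Every point of a fibre has a preimage under the truncated envelope at which the envelope
agrees with the original lift. -/
theorem IsDegreeOneLift.exists_truncatedEnvelope_eq (hG : IsDegreeOneLift G) {t : ℝ} (ht : 0 ≤ t)
    (θ : Θ) (y : ℝ) : ∃ x, truncatedEnvelope G t (θ, x) = y ∧ G (θ, x) = y := by
  have hT := hG.isMonotoneLift_truncatedEnvelope t
  have hlow := hG.isMonotoneLift_lowerEnvelope
  have hle : ∀ x, truncatedEnvelope G t (θ, x) ≤ lowerEnvelope G (θ, x) + t := fun x => by
    obtain ⟨z, hz, h⟩ := (hG.truncation t).exists_upperEnvelope_eq θ x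
    rw [truncatedEnvelope, h]
    have h1 := hlow.monotone θ hz
    simp only at h1
    exact (min_le_right _ _).trans (by linarith)
  obtain ⟨x, hx⟩ := hT.exists_apply_eq θ y
  obtain ⟨α, hα, h⟩ := (hG.truncation t).exists_upperEnvelope_eq θ x
  rw [truncatedEnvelope, h] at hx
  have hαT : truncatedEnvelope G t (θ, α) = y := by
    refine le_antisymm ?_ ?_
    · rw [← hx, ← h]; exact hT.monotone θ hα
    · rw [← hx]; exact (hG.truncation t).le_upperEnvelope θ le_rfl
  rcases min_choice (G (θ, α)) (lowerEnvelope G (θ, α) + t) with h1 | h1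
  · exact ⟨α, hαT, by rw [← hx, h1]⟩
  · have hGα : y ≤ G (θ, α) := by rw [← hx]; exact min_le_left _ _
    rw [h1] at hx
    obtain ⟨β, hβ, hβG⟩ := hG.exists_lowerEnvelope_eq θ α
    obtain ⟨z, hz, hzG⟩ := intermediate_value_Icc' hβ
      (hG.continuousOn_fibre θ continuous_id _) (show y ∈ Set.Icc (G (θ, id β)) (G (θ, id α)) from
        ⟨by simp only [id]; linarith, hGα⟩)
    refine ⟨z, le_antisymm ?_ ?_, hzG⟩
    · have h2 := hlow.monotone θ hz.2
      have h3 := hG.lowerEnvelope_le θ (le_refl β)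
      simp only at h2
      linarith [hle z]
    · rw [← hαT]; exact hT.monotone θ hz.1

/-- Some orbit of the truncated envelope never leaves the set where it agrees with `G`. -/
theorem IsDegreeOneLift.exists_forall_iterate_eq (hG : IsDegreeOneLift G) {r : Θ → Θ}
    (hr : Continuous r) {t : ℝ} (ht : 0 ≤ t) (θ : Θ) :
    ∃ x, ∀ n, G ((skewProduct r (truncatedEnvelope G t))^[n] (θ, x)) =
      truncatedEnvelope G t ((skewProduct r (truncatedEnvelope G t))^[n] (θ, x)) := by
  set T := truncatedEnvelope G t with hTdef
  have hT : IsMonotoneLift T := hG.isMonotoneLift_truncatedEnvelope t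
  have hsurj : ∀ n θ, ∃ x, ∀ k < n, G ((skewProduct r T)^[k] (θ, x)) =
      T ((skewProduct r T)^[k] (θ, x)) := by
    intro n
    induction n with
    | zero => exact fun θ => ⟨0, fun k hk => absurd hk (Nat.not_lt_zero k)⟩
    | succ n ih =>
      intro θ
      obtain ⟨z, hz⟩ := ih (r θ)
      obtain ⟨x, hx, hx'⟩ := hG.exists_truncatedEnvelope_eq ht θ z
      refine ⟨x, fun k hk => ?_⟩
      rcases k with _ | k
      · exact hx'.trans hx.symm
      · have h1 : skewProduct r T (θ, x) = (r θ, z) := Prod.ext rfl hx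
        rw [Function.iterate_succ_apply, h1]
        exact hz k (by omega)
  let K : ℕ → Set ℝ := fun n => Set.Icc 0 1 ∩ {x | ∀ k < n, G ((skewProduct r T)^[k] (θ, x)) =
      T ((skewProduct r T)^[k] (θ, x))}
  have hcl : ∀ n, IsClosed (K n) := fun n => by
    refine isClosed_Icc.inter ?_
    simp only [Set.ofPred_forall]
    refine isClosed_iInter fun k => isClosed_iInter fun _ => ?_
    have hc : Continuous fun x : ℝ => (skewProduct r T)^[k] (θ, x) :=
      (continuous_skewProduct_iterate hr hT.continuous k).comp
        (continuous_const.prodMk continuous_id)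
    exact isClosed_eq (hG.continuous.comp hc) (hT.continuous.comp hc)
  have hne : ∀ n, (K n).Nonempty := fun n => by
    obtain ⟨x, hx⟩ := hsurj n θ
    refine ⟨Int.fract x, ⟨Int.fract_nonneg x, (Int.fract_lt_one x).le⟩, fun k hk => ?_⟩
    have h1 : (skewProduct r T)^[k] (θ, x) = (((skewProduct r T)^[k] (θ, Int.fract x)).1,
        ((skewProduct r T)^[k] (θ, Int.fract x)).2 + (⌊x⌋ : ℤ)) := by
      refine Prod.ext ?_ ?_
      · simp [skewProduct_iterate_fst]
      · have := (hT.toIsDegreeOneLift.iterate hr k).apply_add_int θ (Int.fract x) ⌊x⌋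
        rwa [Int.fract_add_floor] at this
    have h2 := hx k hk
    rw [h1, hG.apply_add_int, hT.apply_add_int] at h2
    exact add_right_cancel h2
  obtain ⟨x, hx⟩ := IsCompact.nonempty_iInter_of_sequence_nonempty_isCompact_isClosed K
    (fun n x hx => ⟨hx.1, fun k hk => hx.2 k (by omega)⟩) hne
    (isCompact_Icc.of_isClosed_subset (hcl 0) Set.inter_subset_left) hcl
  exact ⟨x, fun n => (Set.mem_iInter.1 hx (n + 1)).2 n (Nat.lt_succ_self n)⟩

end

theorem exists_isMinimalSet_subset {X : Type*} [TopologicalSpace X] [CompactSpace X] {f : X → X}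
    {K : Set X} (hK : IsClosed K) (hne : K.Nonempty) (hf : Set.MapsTo f K K) :
    ∃ M ⊆ K, IsMinimalSet f M := by
  obtain ⟨M, hMK, hM⟩ := zorn_superset_nonempty
    {N : Set X | IsClosed N ∧ N.Nonempty ∧ Set.MapsTo f N N} (fun c hc hchain hcne => by
      refine ⟨⋂₀ c, ⟨isClosed_sInter fun s hs => (hc hs).1, ?_, ?_⟩,
        fun s hs => Set.sInter_subset_of_mem hs⟩
      · have := hcne.to_subtype
        exact IsCompact.nonempty_sInter_of_directed_nonempty_isCompact_isClosed
          (fun s hs s' hs' => (hchain.total hs hs').elim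
            (fun h => ⟨s, hs, subset_rfl, h⟩) fun h => ⟨s', hs', h, subset_rfl⟩)
          (fun s hs => (hc hs).2.1)
          (fun s hs => (hc hs).1.isCompact) fun s hs => (hc hs).1
      · exact fun x hx s hs => (hc hs).2.2 (hx s hs)) K ⟨hK, hne, hf⟩
  exact ⟨M, hMK, hM.prop.1, hM.prop.2.1, hM.prop.2.2, fun N hNM h1 h2 h3 =>
    Set.Subset.antisymm hNM (hM.le_of_le ⟨h1, h2, h3⟩ hNM)⟩

theorem isOpenQuotientMap_circleProj (Θ : Type*) [TopologicalSpace Θ] :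
    IsOpenQuotientMap (circleProj Θ) :=
  IsOpenQuotientMap.id.prodMap
    (QuotientAddGroup.isOpenQuotientMap_mk (N := AddSubgroup.zmultiples (1 : ℝ)))

section

variable {Θ : Type*}

theorem exists_int_of_circleProj_eq {p q : Θ × ℝ} (h : circleProj Θ p = circleProj Θ q) :
    ∃ k : ℤ, p = (q.1, q.2 + k) := by
  have h1 : p.1 = q.1 := congrArg (fun u : Θ × UnitAddCircle => u.1) h
  have h2 : (p.2 : UnitAddCircle) = (q.2 : UnitAddCircle) :=
    congrArg (fun u : Θ × UnitAddCircle => u.2) h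
  obtain ⟨k, hk⟩ := AddSubgroup.mem_zmultiples_iff.1 (QuotientAddGroup.eq_iff_sub_mem.1 h2)
  refine ⟨k, Prod.ext h1 ?_⟩
  simp only [zsmul_eq_mul, mul_one] at hk
  simp [hk]

variable [TopologicalSpace Θ]

theorem isClosed_circleProj_image_setOf_eq {G H : Θ × ℝ → ℝ} (hG : IsDegreeOneLift G)
    (hH : IsDegreeOneLift H) :
    IsClosed (circleProj Θ '' {p | G p = H p}) ∧
      circleProj Θ ⁻¹' (circleProj Θ '' {p | G p = H p}) = {p | G p = H p} := by
  have h : circleProj Θ ⁻¹' (circleProj Θ '' {p | G p = H p}) = {p | G p = H p} := by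
    refine Set.Subset.antisymm ?_ (Set.subset_preimage_image _ _)
    rintro p ⟨q, hq, hpq⟩
    obtain ⟨k, rfl⟩ := exists_int_of_circleProj_eq hpq.symm
    have hq' : G q = H q := hq
    change G (q.1, q.2 + k) = H (q.1, q.2 + k)
    rw [hG.apply_add_int, hH.apply_add_int, hq']
  refine ⟨?_, h⟩
  rw [← (isOpenQuotientMap_circleProj Θ).isQuotientMap.isClosed_preimage, h]
  exact isClosed_eq hG.continuous hH.continuous

theorem IsLift.circleProj_iterate {F : C(Θ × ℝ, Θ × ℝ)}
    {f : C(Θ × UnitAddCircle, Θ × UnitAddCircle)} (hF : IsLift F f) (n : ℕ) (p : Θ × ℝ) :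
    circleProj Θ (F^[n] p) = f^[n] (circleProj Θ p) :=
  (Function.Semiconj.iterate_right (f := circleProj Θ) hF n) p

/-- A minimal set over which a lift coincides with its truncated envelope along full orbits. -/
theorem exists_isMinimalSet_iterate_eq [CompactSpace Θ] [Nonempty Θ] {r : C(Θ, Θ)}
    {f : C(Θ × UnitAddCircle, Θ × UnitAddCircle)} {F : C(Θ × ℝ, Θ × ℝ)} (hF : IsLift F f)
    {G : Θ × ℝ → ℝ} (hG : IsDegreeOneLift G) (hFG : ⇑F = skewProduct r G) {t : ℝ} (ht : 0 ≤ t) :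
    ∃ M, IsMinimalSet f M ∧ ∀ p ∈ circleProj Θ ⁻¹' M, ∀ n,
      F^[n] p = (skewProduct r (truncatedEnvelope G t))^[n] p := by
  set T := truncatedEnvelope G t with hTdef
  have hT : IsMonotoneLift T := hG.isMonotoneLift_truncatedEnvelope t
  obtain ⟨hCcl, hC⟩ := isClosed_circleProj_image_setOf_eq hG hT.toIsDegreeOneLift
  set C := circleProj Θ '' {p | G p = T p} with hCdef
  have hmemC : ∀ p n, f^[n] (circleProj Θ p) ∈ C ↔ G (F^[n] p) = T (F^[n] p) := fun p n => by
    rw [← hF.circleProj_iterate]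
    change F^[n] p ∈ circleProj Θ ⁻¹' C ↔ _
    rw [hC]; rfl
  let K : Set (Θ × UnitAddCircle) := {q | ∀ n, f^[n] q ∈ C}
  have hKcl : IsClosed K := by
    have : K = ⋂ n, f^[n] ⁻¹' C := by ext; simp [K]
    rw [this]
    exact isClosed_iInter fun n => hCcl.preimage (f.continuous.iterate n)
  have hKne : K.Nonempty := by
    obtain ⟨θ⟩ := ‹Nonempty Θ›
    obtain ⟨x, hx⟩ := hG.exists_forall_iterate_eq r.continuous ht θ
    refine ⟨circleProj Θ (θ, x), fun n => ?_⟩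
    rw [hmemC, hFG, iterate_eq_of_forall_iterate_eq hx n]
    exact hx n
  have hKinv : Set.MapsTo f K K := fun q hq n => by
    rw [← Function.iterate_succ_apply]; exact hq (n + 1)
  obtain ⟨M, hMK, hM⟩ := exists_isMinimalSet_subset hKcl hKne hKinv
  refine ⟨M, hM, fun p hp n => ?_⟩
  have h1 : ∀ n, T ((skewProduct r G)^[n] p) = G ((skewProduct r G)^[n] p) := fun n => by
    rw [← hFG]; exact ((hmemC p n).1 (hMK hp n)).symm
  rw [hFG, iterate_eq_of_forall_iterate_eq h1 n]

end

theorem coverMincard_le_card_of_coding {X : Type*} {T : X → X} {U : SetRel X X} {n : ℕ}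
    {ι : Type*} [Fintype ι] (code : X → ι)
    (h : ∀ x y, code x = code y → (x, y) ∈ Dynamics.dynEntourage T U n) :
    Dynamics.coverMincard T Set.univ U n ≤ Fintype.card ι := by
  classical
  let c : Set.range code → X := fun i => i.2.choose
  have hc : ∀ i : Set.range code, code (c i) = i := fun i => i.2.choose_spec
  have hcov : Dynamics.IsDynCoverOf T Set.univ U n
      ((Finset.univ.image c : Finset X) : Set X) := fun x _ =>
    ⟨c ⟨code x, x, rfl⟩, by simp, h _ _ (hc ⟨code x, x, rfl⟩).symm⟩
  refine hcov.coverMincard_le_card.trans ?_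
  have h1 : (Finset.univ.image c : Finset X).card ≤ Fintype.card ι :=
    Finset.card_image_le.trans (Fintype.card_subtype_le _)
  exact_mod_cast h1

section

variable {Θ : Type*}

/-- The itinerary code of `(θ, x)` of length `m` with respect to the grid of mesh `1 / N`. -/
noncomputable def gridCode (r : Θ → Θ) (H : Θ × ℝ → ℝ) (N m : ℕ) (θ : Θ) (x : ℝ) : ℤ :=
  ∑ k ∈ Finset.range m, ⌊N * ((skewProduct r H)^[k] (θ, x)).2⌋

variable [TopologicalSpace Θ] {r : Θ → Θ} {H : Θ × ℝ → ℝ}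

theorem floor_iterate_le (hr : Continuous r) (hH : IsMonotoneLift H) (N k : ℕ) (θ : Θ) {x y : ℝ}
    (hxy : x ≤ y) : ⌊N * ((skewProduct r H)^[k] (θ, x)).2⌋ ≤
      ⌊N * ((skewProduct r H)^[k] (θ, y)).2⌋ :=
  Int.floor_le_floor (mul_le_mul_of_nonneg_left ((hH.iterate hr k).monotone θ hxy)
    (Nat.cast_nonneg N))

theorem monotone_gridCode (hr : Continuous r) (hH : IsMonotoneLift H) (N m : ℕ) (θ : Θ) :
    Monotone (gridCode r H N m θ) := fun _ _ hxy =>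
  Finset.sum_le_sum fun k _ => floor_iterate_le hr hH N k θ hxy

theorem gridCode_one (hr : Continuous r) (hH : IsMonotoneLift H) (N m : ℕ) (θ : Θ) :
    gridCode r H N m θ 1 = gridCode r H N m θ 0 + m * N := by
  have h1 : ∀ k, ⌊N * ((skewProduct r H)^[k] (θ, 1)).2⌋ =
      ⌊N * ((skewProduct r H)^[k] (θ, 0)).2⌋ + N := fun k => by
    have h2 := (hH.iterate hr k).apply_add_one θ 0
    rw [zero_add] at h2
    rw [h2, mul_add, mul_one, Int.floor_add_natCast]
  simp [gridCode, h1, Finset.sum_add_distrib]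

theorem abs_iterate_sub_lt_of_gridCode_eq (hr : Continuous r) (hH : IsMonotoneLift H) {N m : ℕ}
    (hN : 0 < N) {θ : Θ} {x y : ℝ} (h : gridCode r H N m θ x = gridCode r H N m θ y) {k : ℕ}
    (hk : k < m) :
    |((skewProduct r H)^[k] (θ, x)).2 - ((skewProduct r H)^[k] (θ, y)).2| < 1 / N := by
  wlog hxy : x ≤ y generalizing x y
  · rw [abs_sub_comm]
    exact this h.symm (le_of_not_ge hxy)
  have h1 := (Finset.sum_eq_sum_iff_of_le fun k _ => floor_iterate_le hr hH N k θ hxy).1 h k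
    (Finset.mem_range.2 hk)
  have h2 := Int.abs_sub_lt_one_of_floor_eq_floor h1
  have hN' : (0 : ℝ) < N := by exact_mod_cast hN
  rw [← mul_sub, abs_mul, abs_of_pos hN'] at h2
  rw [lt_div_iff₀ hN']
  linarith

end

section

variable {Θ : Type*} [MetricSpace Θ] [CompactSpace Θ] {r : Θ → Θ} {H : Θ × ℝ → ℝ}

theorem eventually_uniformity_abs_iterate_sub_lt (hr : Continuous r) (hH : IsMonotoneLift H)
    (m : ℕ) {ε : ℝ} (hε : 0 < ε) :
    ∀ᶠ q in uniformity Θ, ∀ k < m, ∀ x ∈ Set.Icc (0 : ℝ) 1,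
      |((skewProduct r H)^[k] (q.1, x)).2 - ((skewProduct r H)^[k] (q.2, x)).2| < ε := by
  have h1 : ∀ k ∈ Finset.range m, ∀ᶠ q in uniformity Θ, ∀ x ∈ Set.Icc (0 : ℝ) 1,
      |((skewProduct r H)^[k] (q.1, x)).2 - ((skewProduct r H)^[k] (q.2, x)).2| < ε := by
    intro k _
    have huc := (isCompact_univ.prod (isCompact_Icc (a := (0 : ℝ)) (b := 1)) :
      IsCompact ((Set.univ : Set Θ) ×ˢ Set.Icc (0 : ℝ) 1)).uniformContinuousOn_of_continuous
      (hH.iterate hr k).continuous.continuousOn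
    obtain ⟨η, hη, h⟩ := Metric.uniformContinuousOn_iff.1 huc ε hε
    refine Metric.mem_uniformity_dist.2 ⟨η, hη, fun {a b} hab x hx => ?_⟩
    have := h (a, x) ⟨trivial, hx⟩ (b, x) ⟨trivial, hx⟩ (by simpa [Prod.dist_eq, hη] using hab)
    rwa [Real.dist_eq] at this
  have h2 := (Filter.eventually_all_finset (Finset.range m)).2 h1
  exact h2.mono fun q hq k hk => hq k (Finset.mem_range.2 hk)

theorem dist_coe_unitAddCircle_le (a b : ℝ) :
    dist (a : UnitAddCircle) (b : UnitAddCircle) ≤ |a - b| := by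
  rw [dist_eq_norm, ← AddCircle.coe_sub, ← Real.norm_eq_abs]
  exact QuotientAddGroup.norm_mk_le_norm

/-- Dynamical covers of a system fibred over `r` by monotone degree one circle maps: each block of
length `m` contributes at most `m * N + 1` itineraries. -/
theorem exists_coverMincard_le (hr : Continuous r) (hH : IsMonotoneLift H)
    {M : Set (Θ × UnitAddCircle)} {g : M → M}
    (hg : ∀ (p : M) (q : Θ × ℝ), circleProj Θ q = p → circleProj Θ (skewProduct r H q) = g p)
    {ε : ℝ} (hε : 0 < ε) {N : ℕ} (hN : 0 < N) (hNε : 1 / (N : ℝ) ≤ ε / 2) {m : ℕ} (hm : 0 < m) :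
    ∃ U ∈ uniformity Θ, ∀ n, Dynamics.coverMincard g Set.univ {q | dist q.1 q.2 < ε} n ≤
      Dynamics.coverMincard r Set.univ U n * ((m * N + 1) ^ (n / m + 1) : ℕ) := by
  have hgk : ∀ (k : ℕ) (p : M) (q : Θ × ℝ), circleProj Θ q = p →
      circleProj Θ ((skewProduct r H)^[k] q) = g^[k] p := fun k => by
    induction k with
    | zero => exact fun p q h => h
    | succ k ih =>
      intro p q h
      rw [Function.iterate_succ_apply, Function.iterate_succ_apply]
      exact ih _ _ (hg p q h)
  let U : Set (Θ × Θ) := {q | (∀ k < m, ∀ x ∈ Set.Icc (0 : ℝ) 1,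
      |((skewProduct r H)^[k] (q.1, x)).2 - ((skewProduct r H)^[k] (q.2, x)).2| < ε / 4) ∧
      dist q.1 q.2 < ε / 2}
  have hU : U ∈ uniformity Θ := (eventually_uniformity_abs_iterate_sub_lt hr hH m
    (by positivity : 0 < ε / 4)).and (Metric.dist_mem_uniformity (half_pos hε))
  refine ⟨U, hU, fun n => ?_⟩
  rcases eq_or_ne (Dynamics.coverMincard r Set.univ U n) ⊤ with htop | htop
  · rw [htop, ENat.top_mul (by positivity)]
    exact le_top
  obtain ⟨E, hE, hEcard⟩ := (Dynamics.coverMincard_finite_iff r Set.univ U n).1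
    (lt_top_iff_ne_top.2 htop)
  choose b hbE hb using fun θ : Θ => hE (Set.mem_univ θ)
  have hb' : ∀ θ, ∀ k < n, (r^[k] θ, r^[k] (b θ)) ∈ U := fun θ =>
    Dynamics.mem_dynEntourage.1 (hb θ)
  have hrep : ∀ φ : UnitAddCircle, ∃ x ∈ Set.Icc (0 : ℝ) 1, (x : UnitAddCircle) = φ := fun φ =>
    ⟨AddCircle.equivIco 1 0 φ, ⟨(AddCircle.equivIco 1 0 φ).2.1, by
      linarith [(AddCircle.equivIco (1 : ℝ) 0 φ).2.2]⟩, AddCircle.coe_equivIco⟩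
  choose ξ hξ hξφ using hrep
  let X : M → ℕ → ℝ := fun p j => ξ (g^[j * m] p : Θ × UnitAddCircle).2
  let w : M → ℕ → ℤ := fun p j =>
    gridCode r H N m (r^[j * m] (b p.1.1)) (X p j) - gridCode r H N m (r^[j * m] (b p.1.1)) 0
  have hw0 : ∀ p j, 0 ≤ w p j := fun p j =>
    sub_nonneg.2 (monotone_gridCode hr hH N m _ (hξ _).1)
  have hw1 : ∀ p j, w p j ≤ m * N := fun p j => by
    have h1 := monotone_gridCode hr hH N m (r^[j * m] (b p.1.1)) (hξ (g^[j * m] p).1.2).2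
    rw [gridCode_one hr hH] at h1
    simp only [w, X]
    linarith
  let code : M → E × (Fin (n / m + 1) → Fin (m * N + 1)) := fun p =>
    (⟨b p.1.1, hbE _⟩, fun j => ⟨(w p j).toNat, by
      have h1 := hw0 p j
      have h2 := hw1 p j
      zify
      rw [Int.toNat_of_nonneg h1]
      linarith⟩)
  have hfst : ∀ (k : ℕ) (p : M), (g^[k] p : Θ × UnitAddCircle).1 = r^[k] p.1.1 := fun k p => by
    have h1 := hgk k p (p.1.1, ξ p.1.2) (Prod.ext rfl (hξφ _))
    rw [← h1]
    exact skewProduct_iterate_fst r H k _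
  have hblock : ∀ (p : M) (j k : ℕ), (g^[j * m + k] p : Θ × UnitAddCircle).2 =
      (((skewProduct r H)^[k] (r^[j * m] p.1.1, X p j)).2 : ℝ) := fun p j k => by
    rw [add_comm, Function.iterate_add_apply]
    rw [← hgk k (g^[j * m] p) (r^[j * m] p.1.1, X p j) (Prod.ext (hfst _ p).symm (hξφ _))]
    rfl
  have hcode := coverMincard_le_card_of_coding (T := g) (U := {q | dist q.1 q.2 < ε}) (n := n) code
    (fun p p' hpp' => by
      have hbb : b p.1.1 = b p'.1.1 := congrArg (fun c => (c.1 : Θ)) hpp'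
      have hww : ∀ j < n / m + 1, w p j = w p' j := fun j hj => by
        have h1 := congrArg (fun c => ((c.2 ⟨j, hj⟩ : Fin _) : ℕ)) hpp'
        simp only [code] at h1
        have h2 := hw0 p j
        have h3 := hw0 p' j
        omega
      refine Dynamics.mem_dynEntourage.2 fun i hi => ?_
      have hi1 : i / m * m + i % m = i := Nat.div_add_mod' i m
      have hi2 : i % m < m := Nat.mod_lt i hm
      have hi3 : i / m * m < n := (Nat.div_mul_le_self i m).trans_lt hi
      have hi4 : i / m < n / m + 1 := Nat.lt_succ_of_le (Nat.div_le_div_right hi.le)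
      set j := i / m
      set k := i % m
      change dist (g^[i] p) (g^[i] p') < ε
      rw [Subtype.dist_eq, Prod.dist_eq, max_lt_iff]
      constructor
      · rw [hfst, hfst]
        have h1 := (hb' p.1.1 i hi).2
        have h2 := (hb' p'.1.1 i hi).2
        simp only [← hbb] at h1 h2
        have h3 := dist_triangle_right (r^[i] p.1.1) (r^[i] p'.1.1) (r^[i] (b p.1.1))
        linarith
      · rw [← hi1, hblock, hblock]
        refine (dist_coe_unitAddCircle_le _ _).trans_lt ?_
        have h1 := (hb' p.1.1 _ hi3).1 k hi2 (X p j) (hξ _)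
        have h2 := (hb' p'.1.1 _ hi3).1 k hi2 (X p' j) (hξ _)
        have h3 := hww j hi4
        simp only [w, ← hbb] at h3
        have h4 := abs_iterate_sub_lt_of_gridCode_eq hr hH hN (sub_left_injective h3) hi2
        simp only [← hbb] at h1 h2
        rw [abs_lt] at h1 h2 h4 ⊢
        constructor <;> linarith [h1.1, h1.2, h2.1, h2.2, h4.1, h4.2])
  refine hcode.trans (le_of_eq ?_)
  rw [← hEcard]
  simp

theorem tendsto_log_mul_add_one_div (N : ℕ) :
    Tendsto (fun m : ℕ => Real.log (m * N + 1) / m) atTop (𝓝 0) := by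
  have h1 : Tendsto (fun m : ℕ => Real.log m / m) atTop (𝓝 0) :=
    (Real.isLittleO_log_id_atTop.tendsto_div_nhds_zero).comp tendsto_natCast_atTop_atTop
  have h2 : Tendsto (fun m : ℕ => Real.log (N + 1) / m) atTop (𝓝 0) :=
    tendsto_const_div_atTop_nhds_zero_nat _
  refine squeeze_zero' (Eventually.of_forall fun m => div_nonneg (Real.log_nonneg ?_)
    (Nat.cast_nonneg m)) ?_ (by simpa using h1.add h2)
  · have : (0 : ℝ) ≤ m * N := by positivity
    linarith
  · filter_upwards [eventually_gt_atTop 0] with m hm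
    have hm' : (1 : ℝ) ≤ m := by exact_mod_cast hm
    rw [← add_div, ← Real.log_mul (by positivity) (by positivity)]
    gcongr
    nlinarith

theorem expGrowthSup_pow_div_add_one_le {P m : ℕ} (hP : 0 < P) (hm : 0 < m) :
    ExpGrowth.expGrowthSup (fun n => ((P ^ (n / m + 1) : ℕ) : ENNReal)) ≤
      ((Real.log P / m : ℝ) : EReal) := by
  have hP' : (0 : ℝ) < P := by exact_mod_cast hP
  have hm' : (0 : ℝ) < m := by exact_mod_cast hm
  have hlog : 0 ≤ Real.log P := Real.log_natCast_nonneg P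
  rw [← ExpGrowth.expGrowthSup_exp (a := ((Real.log P / m : ℝ) : EReal))]
  refine ExpGrowth.expGrowthSup_le_of_eventually_le (b := (P : ENNReal)) (by simp)
    (Eventually.of_forall fun n => ?_)
  have h1 : ((Real.log P / m : ℝ) : EReal) * (n : EReal) = ((Real.log P / m * n : ℝ) : EReal) := by
    push_cast; rfl
  rw [h1, EReal.exp_coe, pow_succ, mul_comm, Nat.cast_mul]
  gcongr
  have h2 : ((P ^ (n / m) : ℕ) : ℝ) ≤ Real.exp (Real.log P / m * n) := by
    rw [Nat.cast_pow, ← Real.exp_log hP', ← Real.exp_nat_mul, Real.log_exp]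
    apply Real.exp_le_exp.2
    have h3 : ((n / m : ℕ) : ℝ) ≤ n / m := Nat.cast_div_le
    calc ((n / m : ℕ) : ℝ) * Real.log P ≤ n / m * Real.log P := by gcongr
      _ = Real.log P / m * n := by ring
  rw [← ENNReal.ofReal_natCast]
  exact ENNReal.ofReal_le_ofReal h2

/-- Fibrewise monotone degree one circle maps do not increase the entropy of the base. -/
theorem topEntropy_le_of_isMonotoneLift (hr : Continuous r) (hH : IsMonotoneLift H)
    {M : Set (Θ × UnitAddCircle)} {g : M → M}
    (hg : ∀ (p : M) (q : Θ × ℝ), circleProj Θ q = p → circleProj Θ (skewProduct r H q) = g p) :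
    topEntropy g ≤ topEntropy r := by
  rw [topEntropy, Dynamics.coverEntropy_eq_iSup_basis Metric.uniformity_basis_dist]
  refine iSup₂_le fun ε hε => ?_
  obtain ⟨N, hN⟩ := exists_nat_gt (2 / ε)
  have hN0 : (0 : ℝ) < N := lt_trans (by positivity) hN
  have hNε : 1 / (N : ℝ) ≤ ε / 2 := by
    rw [div_lt_iff₀ hε] at hN
    rw [div_le_iff₀ hN0]
    linarith
  have key : ∀ m : ℕ, 0 < m → Dynamics.coverEntropyEntourage g Set.univ {q | dist q.1 q.2 < ε} ≤
      topEntropy r + ((Real.log (m * N + 1) / m : ℝ) : EReal) := fun m hm => by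
    obtain ⟨U, hU, hle⟩ := exists_coverMincard_le hr hH hg hε (by exact_mod_cast hN0) hNε hm
    have h1 := expGrowthSup_pow_div_add_one_le (Nat.succ_pos (m * N)) hm
    have h0 : (0 : EReal) ≤ ExpGrowth.expGrowthSup
        (fun n => (((m * N + 1) ^ (n / m + 1) : ℕ) : ENNReal)) := by
      refine Frequently.le_expGrowthSup (Frequently.of_forall fun n => ?_)
      simp only [zero_mul, EReal.exp_zero]
      exact_mod_cast Nat.one_le_pow _ _ (Nat.succ_pos _)
    have h2 : Dynamics.coverEntropyEntourage g Set.univ {q | dist q.1 q.2 < ε} ≤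
        Dynamics.coverEntropyEntourage r Set.univ U + ExpGrowth.expGrowthSup
          (fun n => (((m * N + 1) ^ (n / m + 1) : ℕ) : ENNReal)) := by
      refine le_trans (ExpGrowth.expGrowthSup_monotone fun n => ?_)
        (ExpGrowth.expGrowthSup_mul_le (Or.inr ?_) (Or.inr ?_))
      · have := ENat.toENNReal_mono (hle n)
        rw [ENat.toENNReal_mul, ENat.toENNReal_coe] at this
        exact this
      · exact ne_top_of_le_ne_top (EReal.coe_ne_top _) h1
      · exact ne_bot_of_le_ne_bot EReal.zero_ne_bot h0
    refine h2.trans (add_le_add (Dynamics.coverEntropyEntourage_le_coverEntropy r _ hU) ?_)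
    simpa using h1
  have hlim : Tendsto (fun m : ℕ => topEntropy r + ((Real.log (m * N + 1) / m : ℝ) : EReal)) atTop
      (𝓝 (topEntropy r + ((0 : ℝ) : EReal))) :=
    Tendsto.comp (g := fun u : EReal × EReal => u.1 + u.2)
      (EReal.continuousAt_add (p := (topEntropy r, ((0 : ℝ) : EReal)))
      (Or.inr (EReal.coe_ne_bot 0)) (Or.inr (EReal.coe_ne_top 0)))
      (tendsto_const_nhds.prodMk_nhds
        ((continuous_coe_real_ereal.tendsto 0).comp (tendsto_log_mul_add_one_div N)))
  rw [EReal.coe_zero, add_zero] at hlim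
  exact ge_of_tendsto hlim ((eventually_gt_atTop 0).mono key)

end

theorem limsup_rotationQuotient_mem_Icc {Θ : Type*} [TopologicalSpace Θ] {r : Θ → Θ}
    {G : Θ × ℝ → ℝ} (hG : IsDegreeOneLift G) {t a b : ℝ} (ht : ∀ p, G p ≤ truncatedEnvelope G t p)
    (ha : TendstoUniformly (rotationQuotient (skewProduct r (truncatedEnvelope G 0)))
      (fun _ => a) atTop)
    (hb : TendstoUniformly (rotationQuotient (skewProduct r (truncatedEnvelope G t)))
      (fun _ => b) atTop) (p : Θ × ℝ) :
    limsup (fun n => rotationQuotient (skewProduct r G) n p) atTop ∈ Set.Icc a b := by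
  have h1 : ∀ n, rotationQuotient (skewProduct r (truncatedEnvelope G 0)) n p ≤
      rotationQuotient (skewProduct r G) n p := fun n => by
    have := skewProduct_iterate_le (r := r) hG.truncatedEnvelope_zero_le
      (Or.inl (hG.isMonotoneLift_truncatedEnvelope 0).monotone) n p
    simp only [rotationQuotient]
    gcongr
  have h2 : ∀ n, rotationQuotient (skewProduct r G) n p ≤
      rotationQuotient (skewProduct r (truncatedEnvelope G t)) n p := fun n => by
    have := skewProduct_iterate_le (r := r) ht
      (Or.inr (hG.isMonotoneLift_truncatedEnvelope t).monotone) n p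
    simp only [rotationQuotient]
    gcongr
  have ha' := ha.tendsto_at p
  have hb' := hb.tendsto_at p
  have hbdd : IsBoundedUnder (· ≤ ·) atTop fun n => rotationQuotient (skewProduct r G) n p :=
    hb'.isBoundedUnder_le.mono_le (Eventually.of_forall h2)
  have hbdd' : IsBoundedUnder (· ≥ ·) atTop fun n => rotationQuotient (skewProduct r G) n p :=
    ha'.isBoundedUnder_ge.mono_ge (Eventually.of_forall h1)
  constructor
  · rw [← ha'.limsup_eq]
    exact limsup_le_limsup (Eventually.of_forall h1) ha'.isBoundedUnder_ge.isCoboundedUnder_le hbdd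
  · rw [← hb'.limsup_eq]
    exact limsup_le_limsup (Eventually.of_forall h2) hbdd'.isCoboundedUnder_le
      hb'.isBoundedUnder_le

section

variable {Θ : Type*} [MetricSpace Θ] [CompactSpace Θ] [Nonempty Θ] {r : C(Θ, Θ)}
  {f : C(Θ × UnitAddCircle, Θ × UnitAddCircle)} {F : C(Θ × ℝ, Θ × ℝ)} {G : Θ × ℝ → ℝ}

theorem exists_isMinimalSet_tendstoUniformlyOn (hF : IsLift F f) (hG : IsDegreeOneLift G)
    (hFG : ⇑F = skewProduct r G) {t ρ : ℝ} (ht : 0 ≤ t)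
    (hρ : TendstoUniformly (rotationQuotient (skewProduct r (truncatedEnvelope G t)))
      (fun _ => ρ) atTop) :
    ∃ (M : Set (Θ × UnitAddCircle)) (hM : IsMinimalSet f M),
      TendstoUniformlyOn (rotationQuotient F) (fun _ => ρ) atTop (circleProj Θ ⁻¹' M) ∧
      (topEntropy r = 0 → topEntropy (hM.mapsTo.restrict f M M) = 0) := by
  obtain ⟨M, hM, hMeq⟩ := exists_isMinimalSet_iterate_eq hF hG hFG ht
  refine ⟨M, hM, ?_, fun h0 => le_antisymm ?_ ?_⟩
  · refine (hρ.tendstoUniformlyOn (s := circleProj Θ ⁻¹' M)).congr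
      (Eventually.of_forall fun n p hp => ?_)
    simp only [rotationQuotient, hMeq p hp n]
  · rw [← h0]
    refine topEntropy_le_of_isMonotoneLift r.continuous (hG.isMonotoneLift_truncatedEnvelope t)
      fun p q hq => ?_
    have h1 := hMeq q (by rw [Set.mem_preimage, hq]; exact p.2) 1
    simp only [Function.iterate_one] at h1
    rw [← h1, hF, hq]
    rfl
  · have : Nonempty M := hM.nonempty.to_subtype
    exact Dynamics.coverEntropy_nonneg _ Set.univ_nonempty

end

theorem theoremt {Θ : Type*} [MetricSpace Θ] [CompactSpace Θ] [MeasurableSpace Θ] [BorelSpace Θ]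
    (r : C(Θ, Θ)) (hr : IsUniquelyErgodic r)
    (f : C(Θ × UnitAddCircle, Θ × UnitAddCircle)) (hf : IsSkewProductOver r f)
    (hhom : IsHomotopicToId r f)
    (F : C(Θ × ℝ, Θ × ℝ)) (hF : IsLift F f) :
    (∃ a b : ℝ, a ≤ b ∧ fibredRotationSet F = Set.Icc a b) ∧
    ∀ ρ ∈ fibredRotationSet F,
      ∃ (M : Set (Θ × UnitAddCircle)) (hM : IsMinimalSet f M),
        TendstoUniformlyOn (rotationQuotient F) (fun _ => ρ) Filter.atTop (circleProj Θ ⁻¹' M) ∧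
        (topEntropy r = 0 → topEntropy (hM.mapsTo.restrict f M M) = 0) := by
  obtain ⟨μ, ⟨hμ, -⟩, hμuniq⟩ := hr
  have huniq : ∀ ν : Measure Θ, IsProbabilityMeasure ν → MeasurePreserving r ν ν → ν = μ :=
    fun ν h1 h2 => hμuniq ν ⟨h1, h2⟩
  have hne : Nonempty Θ := nonempty_of_isProbabilityMeasure μ
  set G : Θ × ℝ → ℝ := fun p => (F p).2 with hGdef
  have hG : IsDegreeOneLift G :=
    ⟨continuous_snd.comp F.continuous, fun θ x => hF.snd_apply_add_one hhom θ x⟩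
  have hFG : ⇑F = skewProduct r G := funext fun p => Prod.ext (hF.fst_apply hf p) rfl
  obtain ⟨R, hRcont, hR⟩ := exists_continuous_rotationNumber (μ := μ)
    hG.isMonotoneLift_truncatedEnvelope hG.continuous_truncatedEnvelope r.continuous huniq
  obtain ⟨t₁, ht₁, hle₁⟩ := hG.exists_le_truncatedEnvelope
  have hmem : ∀ p, limsup (fun n => rotationQuotient F n p) atTop ∈ Set.Icc (R 0) (R t₁) :=
    fun p => by
      rw [hFG]
      exact limsup_rotationQuotient_mem_Icc hG hle₁ (hR 0) (hR t₁) p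
  have hex : ∀ ρ ∈ Set.Icc (R 0) (R t₁), ∃ (M : Set (Θ × UnitAddCircle)) (hM : IsMinimalSet f M),
      TendstoUniformlyOn (rotationQuotient F) (fun _ => ρ) atTop (circleProj Θ ⁻¹' M) ∧
      (topEntropy r = 0 → topEntropy (hM.mapsTo.restrict f M M) = 0) := fun ρ hρ => by
    obtain ⟨t, ht, rfl⟩ := intermediate_value_Icc ht₁ hRcont.continuousOn hρ
    exact exists_isMinimalSet_tendstoUniformlyOn hF hG hFG ht.1 (hR t)
  have hset : fibredRotationSet F = Set.Icc (R 0) (R t₁) := by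
    refine Set.Subset.antisymm (Set.range_subset_iff.2 hmem) fun ρ hρ => ?_
    obtain ⟨M, hM, hunif, -⟩ := hex ρ hρ
    obtain ⟨q, hq⟩ := hM.nonempty
    obtain ⟨p, rfl⟩ := (isOpenQuotientMap_circleProj Θ).surjective q
    exact ⟨p, (hunif.tendsto_at hq).limsup_eq⟩
  obtain ⟨θ₀⟩ := hne
  refine ⟨⟨R 0, R t₁, (hmem (θ₀, 0)).1.trans (hmem (θ₀, 0)).2, hset⟩, fun ρ hρ => hex ρ ?_⟩
  rwa [hset] at hρ
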